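/- Let $\mathcal{K}$ be a locally presentable category and let $\lambda$ be a regular cardinal. Then $\mathcal{K}$ has binary products, and there exists a regular cardinal $\mu > \lambda$ such that for all $\mu$-presentable objects $X$ and $Y$ of $\mathcal{K}$, the binary product $X \times Y$ is $\mu$-presentable. (An object $X$ is $\mu$-presentable if the functor $\mathcal{K}(X,-)$ preserves $\mu$-filtered colimits. A category is locally presentable if, for some regular cardinal $\kappa$, it is locally small, has all small colimits, and has an essentially small collection of $\kappa$-presentable objects such that every object is a small $\kappa$-filtered colimit of objects of that collection.) -/

import Mathlib

open CategoryTheory CategoryTheory.Limits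

universe w v u

namespace Cardinal

/-! Presentability is turned into a cardinality bound. Let `F : J ⥤ K` be a small dense family of
`κ`-presentable objects and `μ = (2 ^ ν)⁺` with `ν` large. Then `X` is `μ`-presentable exactly when
every hom-set `F.obj j ⟶ X` has size `< μ` (`hasCardinalLT_hom_of_isColimit` with
`isCardinalPresentable_of_hasCardinalLT_hom`). Maps into `X × Y` are pairs of maps, and a product of
two sets of size `< μ` has size `< μ`. Limits exist because density makes `K` reflective in
presheaves on `J`. -/

lemma hasCardinalLT_setCardinalLT {κ ν : Cardinal.{w}} (hκ : κ ≤ ν) (hν : ℵ₀ ≤ ν)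
    {X : Type w} (hX : HasCardinalLT X (Order.succ (2 ^ ν))) :
    HasCardinalLT (CardinalDirectedPoset.SetCardinalLT κ X) (Order.succ (2 ^ ν)) := by
  rw [hasCardinalLT_iff_cardinal_mk_lt, Order.lt_succ_iff] at hX ⊢
  calc #(CardinalDirectedPoset.SetCardinalLT κ X)
      ≤ #{A : Set X // #A ≤ ν} := mk_subtype_mono fun A hA ↦ by
        rw [hasCardinalLT_iff_cardinal_mk_lt] at hA
        exact hA.le.trans hκ
    _ ≤ max #X ℵ₀ ^ ν := mk_bounded_set_le X ν
    _ ≤ (2 ^ ν) ^ ν := power_le_power_right (max_le hX (hν.trans (cantor ν).le))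
    _ = 2 ^ ν := by rw [← power_mul, mul_eq_self hν]

end Cardinal

namespace CategoryTheory

variable {C : Type u} [Category.{v} C]

section

variable {I : Type w} [PartialOrder I] (κ μ : Cardinal.{w}) (D : I ⥤ C)

/-- The `κ`-directed subsets of cardinality `< μ` of a partially ordered type. -/
abbrev DirectedSubset (I : Type w) [PartialOrder I] (κ μ : Cardinal.{w}) [Fact κ.IsRegular] :=
  { A : Set I // IsCardinalFiltered A κ ∧ HasCardinalLT A μ }

namespace DirectedSubset

variable [Fact κ.IsRegular]

/-- The restriction of a diagram to a subset of the indexing poset. -/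
abbrev restrict (A : DirectedSubset I κ μ) : A.1 ⥤ C :=
  (Subtype.mono_coe (· ∈ A.1)).functor ⋙ D

variable [HasColimitsOfSize.{w, w} C]

variable {κ μ}

/-- The colimit of the restriction of a diagram to a directed subset. -/
noncomputable def colim (A : DirectedSubset I κ μ) : C := colimit (restrict κ μ D A)

/-- The structure morphisms to `colim D A`. -/
noncomputable def ι (A : DirectedSubset I κ μ) (i : I) (hi : i ∈ A.1) : D.obj i ⟶ colim D A :=
  colimit.ι (restrict κ μ D A) ⟨i, hi⟩

lemma w (A : DirectedSubset I κ μ) {i j : I} (f : i ⟶ j) (hi : i ∈ A.1) (hj : j ∈ A.1) :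
    D.map f ≫ ι D A j hj = ι D A i hi :=
  colimit.w (restrict κ μ D A) (homOfLE (leOfHom f) : (⟨i, hi⟩ : A.1) ⟶ ⟨j, hj⟩)

lemma w_assoc (A : DirectedSubset I κ μ) {i j : I} (f : i ⟶ j) (hi : i ∈ A.1) (hj : j ∈ A.1)
    {X : C} (g : colim D A ⟶ X) : D.map f ≫ ι D A j hj ≫ g = ι D A i hi ≫ g := by
  rw [← w D A f hi hj, Category.assoc]

variable {D} in
lemma hom_ext {A : DirectedSubset I κ μ} {X : C} {f g : colim D A ⟶ X}
    (h : ∀ i hi, ι D A i hi ≫ f = ι D A i hi ≫ g) : f = g :=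
  colimit.hom_ext fun i ↦ h i.1 i.2

variable {D} in
/-- Morphisms from `colim D A` are defined by compatible families. -/
noncomputable def desc {A : DirectedSubset I κ μ} {X : C} (f : ∀ i ∈ A.1, D.obj i ⟶ X)
    (hf : ∀ ⦃i j : I⦄ (φ : i ⟶ j) (hi : i ∈ A.1) (hj : j ∈ A.1), D.map φ ≫ f j hj = f i hi) :
    colim D A ⟶ X :=
  colimit.desc (restrict κ μ D A)
    { pt := X
      ι :=
        { app i := f i.1 i.2
          naturality i j φ := (hf (homOfLE (leOfHom φ)) i.2 j.2).trans (Category.comp_id _).symm } }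

@[simp]
lemma ι_desc {A : DirectedSubset I κ μ} {X : C} (f : ∀ i ∈ A.1, D.obj i ⟶ X)
    (hf : ∀ ⦃i j : I⦄ (φ : i ⟶ j) (hi : i ∈ A.1) (hj : j ∈ A.1), D.map φ ≫ f j hj = f i hi)
    (i : I) (hi : i ∈ A.1) : ι D A i hi ≫ desc f hf = f i hi :=
  colimit.ι_desc _ _

@[simp]
lemma ι_desc_assoc {A : DirectedSubset I κ μ} {X Y : C} (f : ∀ i ∈ A.1, D.obj i ⟶ X)
    (hf : ∀ ⦃i j : I⦄ (φ : i ⟶ j) (hi : i ∈ A.1) (hj : j ∈ A.1), D.map φ ≫ f j hj = f i hi)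
    (i : I) (hi : i ∈ A.1) (g : X ⟶ Y) : ι D A i hi ≫ desc f hf ≫ g = f i hi ≫ g := by
  rw [← ι_desc D f hf i hi, Category.assoc]

/-- The morphism between colimits induced by an inclusion of directed subsets. -/
noncomputable def map {A B : DirectedSubset I κ μ} (h : A ≤ B) : colim D A ⟶ colim D B :=
  desc (fun i hi ↦ ι D B i (h hi)) fun _ _ φ _ _ ↦ w D B φ _ _

@[simp]
lemma ι_map {A B : DirectedSubset I κ μ} (h : A ≤ B) (i : I) (hi : i ∈ A.1) :
    ι D A i hi ≫ map D h = ι D B i (h hi) :=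
  ι_desc _ _ _ _ _

@[simp]
lemma ι_map_assoc {A B : DirectedSubset I κ μ} (h : A ≤ B) (i : I) (hi : i ∈ A.1) {X : C}
    (g : colim D B ⟶ X) : ι D A i hi ≫ map D h ≫ g = ι D B i (h hi) ≫ g := by
  rw [← ι_map D h, Category.assoc]

/-- The functor sending a directed subset to the colimit over it. -/
@[simps]
noncomputable def colimitFunctor : DirectedSubset I κ μ ⥤ C where
  obj A := colim D A
  map f := map D (leOfHom f)
  map_id A := hom_ext fun i hi ↦ by simp
  map_comp f g := hom_ext fun i hi ↦ by simp

variable (κ μ) {D} in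
/-- The colimits over directed subsets map to the point of any cocone over the whole diagram. -/
@[simps]
noncomputable def cocone (c : Cocone D) : Cocone (colimitFunctor (κ := κ) (μ := μ) D) where
  pt := c.pt
  ι :=
    { app A := desc (fun i _ ↦ c.ι.app i) fun _ _ φ _ _ ↦ c.w φ
      naturality A B f := by
        refine (hom_ext fun i hi ↦ ?_ : map D (leOfHom f) ≫ _ = _).trans (Category.comp_id _).symm
        rw [ι_map_assoc, ι_desc, ι_desc] }

variable {D} in
lemma ι_app_eq [IsDirectedOrder (DirectedSubset I κ μ)] (s : Cocone (colimitFunctor D))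
    (i : I) (A B : DirectedSubset I κ μ) (hA : i ∈ A.1) (hB : i ∈ B.1) :
    ι D A i hA ≫ s.ι.app A = ι D B i hB ≫ s.ι.app B := by
  obtain ⟨E, hAE, hBE⟩ := exists_ge_ge A B
  rw [← s.w (homOfLE hAE), ← s.w (homOfLE hBE)]
  exact (ι_map_assoc D hAE i hA _).trans (ι_map_assoc D hBE i hB _).symm

variable {D} in
/-- The cocone over the whole diagram obtained by glueing a cocone over the colimits
over directed subsets which cover the poset. -/
@[simps]
noncomputable def glue [IsDirectedOrder (DirectedSubset I κ μ)]
    (h : ∀ i : I, ∃ A : DirectedSubset I κ μ, i ∈ A.1)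
    (s : Cocone (colimitFunctor (κ := κ) (μ := μ) D)) : Cocone D where
  pt := s.pt
  ι :=
    { app i := ι D (h i).choose i (h i).choose_spec ≫ s.ι.app (h i).choose
      naturality i j f := by
        obtain ⟨B, hB, hB'⟩ := exists_ge_ge (h i).choose (h j).choose
        have hi := hB (h i).choose_spec
        have hj := hB' (h j).choose_spec
        rw [ι_app_eq s i _ B _ hi, ι_app_eq s j _ B _ hj]
        exact (w_assoc D B f hi hj _).trans (Category.comp_id _).symm }

lemma ι_cocone_ι_app_assoc {c : Cocone D} (A : DirectedSubset I κ μ) (i : I) (hi : i ∈ A.1)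
    {X : C} (g : c.pt ⟶ X) :
    ι D A i hi ≫ (cocone κ μ c).ι.app A ≫ g = c.ι.app i ≫ g :=
  ι_desc_assoc D (fun i _ ↦ c.ι.app i) (fun _ _ φ _ _ ↦ c.w φ) i hi g

variable {D} in
/-- A colimit over a poset is the colimit of the colimits over directed subsets which cover it. -/
noncomputable def isColimitCocone {c : Cocone D} (hc : IsColimit c)
    [IsDirectedOrder (DirectedSubset I κ μ)]
    (h : ∀ i : I, ∃ A : DirectedSubset I κ μ, i ∈ A.1) :
    IsColimit (cocone κ μ c) where
  desc s := hc.desc (glue h s)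
  fac s A := hom_ext fun i hi ↦
    (ι_cocone_ι_app_assoc D A i hi (hc.desc (glue h s))).trans
      ((hc.fac (glue h s) i).trans (ι_app_eq s i _ A _ hi))
  uniq s m hm := hc.uniq (glue h s) m fun i ↦
    (ι_cocone_ι_app_assoc D (h i).choose i (h i).choose_spec m).symm.trans
      (congrArg (ι D (h i).choose i (h i).choose_spec ≫ ·) (hm (h i).choose))

lemma isCardinalFiltered [Fact μ.IsRegular]
    (h : ∀ A : Set I, HasCardinalLT A μ →
      ∃ B : Set I, A ⊆ B ∧ IsCardinalFiltered B κ ∧ HasCardinalLT B μ) :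
    IsCardinalFiltered (DirectedSubset I κ μ) μ :=
  isCardinalFiltered_preorder _ _ fun K f hK ↦ by
    rw [← hasCardinalLT_iff_cardinal_mk_lt] at hK
    obtain ⟨B, hB, hB'⟩ := h (⋃ k, (f k).1) (hasCardinalLT_iUnion _ hK fun k ↦ (f k).2.2)
    exact ⟨⟨B, hB'⟩, fun k ↦ (Set.subset_iUnion (fun k ↦ (f k).1) k).trans hB⟩

end DirectedSubset

end

/-- The `κ`-directed colimit `c.pt` is also the `μ`-directed colimit of its subcolimits over
`κ`-directed subsets of size `< μ`. By `μ`-presentability the identity factors through one of these,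
so `c.pt` is a retract of a small subcolimit. Maps from `Q` into that subcolimit factor through one
of its fewer than `μ` stages. -/
lemma hasCardinalLT_hom_of_isColimit {I : Type w} [PartialOrder I] {κ μ : Cardinal.{w}}
    [Fact κ.IsRegular] [Fact μ.IsRegular] [HasColimitsOfSize.{w, w} C] (hκμ : κ < μ)
    (hμ : ∀ (X : Type w), HasCardinalLT X μ →
      HasCardinalLT (CardinalDirectedPoset.SetCardinalLT κ X) μ)
    [IsCardinalFiltered I κ] {D : I ⥤ C} {c : Cocone D} (hc : IsColimit c)
    [IsCardinalPresentable c.pt μ] (Q : C) [IsCardinalPresentable Q κ]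
    (hQ : ∀ i, HasCardinalLT (Q ⟶ D.obj i) μ) :
    HasCardinalLT (Q ⟶ c.pt) μ := by
  have hμ' (A : Set I) (hA : HasCardinalLT A μ) :
      ∃ B : Set I, A ⊆ B ∧ IsCardinalFiltered B κ ∧ HasCardinalLT B μ :=
    -- The poset of subsets of size `< κ` is itself of size `< μ`, so all of it serves as the small
    -- cofinal set.
    Cardinal.SharplyLT.exists_isCardinalFiltered_set_of_exists_cofinal hκμ
      (fun X hX ↦ ⟨Set.univ, (hμ X hX).of_injective _ Subtype.val_injective, .univ⟩) A hA
  have := DirectedSubset.isCardinalFiltered hμ'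
  have hsingle (i : I) : ∃ A : DirectedSubset I κ μ, i ∈ A.1 := by
    obtain ⟨B, hB, hB'⟩ := hμ' {i}
      (hasCardinalLT_of_finite _ _ (Cardinal.IsRegular.aleph0_le Fact.out))
    exact ⟨⟨B, hB'⟩, hB rfl⟩
  have := isFiltered_of_isCardinalFiltered (DirectedSubset I κ μ) μ
  have := IsFiltered.isDirectedOrder (DirectedSubset I κ μ)
  obtain ⟨A, f, hf⟩ := IsCardinalPresentable.exists_hom_of_isColimit (X := c.pt) μ
    (DirectedSubset.isColimitCocone (κ := κ) (μ := μ) hc hsingle) (𝟙 c.pt)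
  have := A.2.1
  refine ((hasCardinalLT_sigma (fun a : A.1 ↦ (Q ⟶ D.obj a.1)) μ A.2.2
    (fun a ↦ hQ a.1)).of_surjective (Y := Q ⟶ DirectedSubset.colim D A)
    (fun g ↦ g.2 ≫ DirectedSubset.ι D A g.1 g.1.2) fun g ↦ ?_).of_injective
    (fun g ↦ g ≫ f) fun g₁ g₂ hg ↦ ?_
  · obtain ⟨a, g', hg'⟩ := IsCardinalPresentable.exists_hom_of_isColimit (X := Q) κ
      (colimit.isColimit (DirectedSubset.restrict κ μ D A)) g
    exact ⟨⟨a, g'⟩, hg'⟩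
  · rw [← Category.comp_id g₁, ← Category.comp_id g₂, ← hf]
    exact (Category.assoc _ _ _).symm.trans
      ((hg =≫ (DirectedSubset.cocone κ μ c).ι.app A).trans (Category.assoc _ _ _))

/-- By density `X` is the colimit of its canonical diagram, and a colimit of `μ`-presentables over
fewer than `μ` arrows is `μ`-presentable. -/
lemma isCardinalPresentable_of_hasCardinalLT_hom [LocallySmall.{w} C]
    {J : Type w} [SmallCategory J] (F : J ⥤ C) [F.IsDense] {μ : Cardinal.{w}}
    [Fact μ.IsRegular] [∀ j, IsCardinalPresentable (F.obj j) μ]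
    (hJ : HasCardinalLT (Arrow J) μ) {X : C} (hX : ∀ j, HasCardinalLT (F.obj j ⟶ X) μ) :
    IsCardinalPresentable X μ := by
  have : HasLimitsOfShape (CostructuredArrow F X)ᵒᵖ (Type w) :=
    hasLimitsOfShape_of_equivalence (equivSmallModel.{w} (CostructuredArrow F X)).op.symm
  have (k : CostructuredArrow F X) :
      IsCardinalPresentable ((CostructuredArrow.proj F X ⋙ F).obj k) μ := by
    dsimp; infer_instance
  refine isCardinalPresentable_of_isColimit _ (F.denseAt X) μ ?_
  -- An arrow of the comma category is determined by an arrow of `J` and the structure map of its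
  -- target.
  refine (hasCardinalLT_sigma (fun f : Arrow J ↦ (F.obj f.right ⟶ X)) μ hJ
    (fun f ↦ hX _)).of_surjective
    (fun g ↦ Arrow.mk (CostructuredArrow.homMk g.1.hom :
      CostructuredArrow.mk (F.map g.1.hom ≫ g.2) ⟶ CostructuredArrow.mk g.2)) fun φ ↦ ?_
  obtain ⟨S, T, f⟩ := φ
  obtain ⟨Y, y, rfl⟩ := S.mk_surjective
  obtain ⟨Z, z, rfl⟩ := T.mk_surjective
  change CostructuredArrow.mk y ⟶ CostructuredArrow.mk z at f
  obtain ⟨f, hf, rfl⟩ := CostructuredArrow.homMk_surjective f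
  dsimp at f hf
  subst hf
  exact ⟨⟨Arrow.mk f, z⟩, rfl⟩

/-- The restricted Yoneda functor is fully faithful by density and has a left adjoint by
cocompleteness, so limits are inherited from presheaves. `ShrinkHoms` brings the hom-sets into `Type
w`. -/
lemma hasLimitsOfSize_of_isDense [HasColimitsOfSize.{w, w} C] [LocallySmall.{w} C]
    {J : Type w} [SmallCategory J] (F : J ⥤ C) [F.IsDense] :
    HasLimitsOfSize.{w, w} C := by
  let e := ShrinkHoms.equivalence.{w} C
  have : HasColimitsOfSize.{w, w} (ShrinkHoms.{u} C) :=
    Adjunction.has_colimits_of_equivalence e.inverse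
  let G : J ⥤ ShrinkHoms.{u} C := F ⋙ e.functor
  let adj := Presheaf.uliftYonedaAdjunction.{w}
    (uliftYoneda.{w}.leftKanExtension G) (uliftYoneda.{w}.leftKanExtensionUnit G)
  let _ : Reflective (Presheaf.restrictedULiftYoneda.{w} G) := { L := _, adj := adj }
  have : HasLimitsOfSize.{w, w} (ShrinkHoms.{u} C) :=
    hasLimits_of_reflective (Presheaf.restrictedULiftYoneda.{w} G)
  exact Adjunction.has_limits_of_equivalence e.functor

variable (C) in
lemma exists_isDense (κ : Cardinal.{w}) [Fact κ.IsRegular] [IsCardinalLocallyPresentable C κ] :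
    ∃ (J : Type w) (_ : SmallCategory J) (F : J ⥤ C), F.IsDense ∧
      (∀ j, IsCardinalPresentable (F.obj j) κ) ∧
      ∀ X : C, IsCardinalPresentable X κ → ∃ j, Nonempty (F.obj j ≅ X) := by
  let P := isCardinalPresentable C κ
  let e := equivSmallModel.{w} P.FullSubcategory
  exact ⟨SmallModel.{w} P.FullSubcategory, inferInstance, e.inverse ⋙ P.ι, inferInstance,
    fun j ↦ (e.inverse.obj j).property,
    fun X hX ↦ ⟨e.functor.obj ⟨X, hX⟩, ⟨P.ι.mapIso (e.unitIso.symm.app ⟨X, hX⟩)⟩⟩⟩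

end CategoryTheory

theorem mainTheorem7 (K : Type u) [Category.{v} K] [IsLocallyPresentable.{w} K]
    (lam : Cardinal.{w}) (hlam : lam.IsRegular) :
    HasBinaryProducts K ∧
      ∃ (μ : Cardinal.{w}) (_ : Fact μ.IsRegular), lam < μ ∧
        ∀ X Y : K, IsCardinalPresentable X μ → IsCardinalPresentable Y μ →
          ∀ P : BinaryFan X Y, Nonempty (IsLimit P) → IsCardinalPresentable P.pt μ := by
  obtain ⟨κ, _, _⟩ := IsLocallyPresentable.exists_cardinal.{w} K
  obtain ⟨J, _, F, _, hF, hF'⟩ := exists_isDense K κ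
  have := hasLimitsOfSize_of_isDense F
  have : HasLimitsOfSize.{0, 0} K := hasLimitsOfSizeShrink.{0, 0} K
  refine ⟨inferInstance, ?_⟩
  obtain ⟨α, hα, hJα⟩ := HasCardinalLT.exists_regular_cardinal.{w}
    (Arrow J ⊕ Σ (p : J × J), F.obj p.1 ⟶ F.obj p.2)
  let ν := max α (max κ lam)
  have hν : Cardinal.aleph0 ≤ ν := hα.aleph0_le.trans (le_max_left _ _)
  -- Successors of infinite cardinals are regular, and `(2 ^ ν) ^ ν = 2 ^ ν` bounds the number of
  -- subsets of size `< κ`.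
  let μ : Cardinal.{w} := Order.succ (2 ^ ν)
  have hνμ : ν < μ := (Cardinal.cantor ν).trans (Order.lt_succ _)
  have : Fact μ.IsRegular := ⟨Cardinal.isRegular_succ (hν.trans (Cardinal.cantor ν).le)⟩
  have hκν : κ ≤ ν := (le_max_left _ _).trans (le_max_right _ _)
  have hlamν : lam ≤ ν := (le_max_right _ _).trans (le_max_right _ _)
  have hJμ := hJα.of_le ((le_max_left _ _).trans hνμ.le : α ≤ μ)
  rw [hasCardinalLT_sum_iff _ _ _ (hν.trans hνμ.le)] at hJμ
  have hFμ (j : J) : IsCardinalPresentable (F.obj j) μ :=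
    isCardinalPresentable_of_le _ (hκν.trans hνμ.le)
  have key (X : K) (hX : IsCardinalPresentable X μ) (j : J) :
      HasCardinalLT (F.obj j ⟶ X) μ := by
    obtain ⟨I, _, _, ⟨p⟩⟩ :=
      (isCardinalFilteredGenerator_isCardinalPresentable K κ).exists_colimitsOfShape X
    obtain ⟨I', _, _, G, _⟩ := IsCardinalFiltered.exists_cardinal_directed I κ
    let c := (Cocone.mk X p.ι).whisker G
    have : IsCardinalPresentable c.pt μ := hX
    refine hasCardinalLT_hom_of_isColimit (c := c) (hκν.trans_lt hνμ)
      (fun X hX ↦ Cardinal.hasCardinalLT_setCardinalLT hκν hν hX)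
      ((Functor.Final.isColimitWhiskerEquiv G _).symm p.isColimit) (F.obj j) fun i ↦ ?_
    -- Each stage is `κ`-presentable, hence isomorphic to some `F.obj j'`, and the maps between such
    -- objects were counted when choosing `α`.
    obtain ⟨j', ⟨e⟩⟩ := hF' _ (p.prop_diag_obj (G.obj i))
    exact hJμ.2.of_injective (fun f ↦ ⟨(j, j'), f ≫ e.inv⟩) fun f g h ↦ by simpa using h
  refine ⟨μ, inferInstance, hlamν.trans_lt hνμ, fun X Y hX hY P ⟨hP⟩ ↦
    isCardinalPresentable_of_hasCardinalLT_hom F hJμ.1 fun j ↦ ?_⟩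
  exact (hasCardinalLT_prod (hν.trans hνμ.le) (key X hX j) (key Y hY j)).of_injective
    (fun f ↦ (f ≫ P.fst, f ≫ P.snd)) fun f g h ↦
      BinaryFan.IsLimit.hom_ext hP (congrArg Prod.fst h) (congrArg Prod.snd h)
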